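/- Let $\mathcal H$ be a real Hilbert space. A multi-valued operator $\mathbb A:\mathcal H\rightrightarrows\mathcal H$ assigns to each $x\in\mathcal H$ a (possibly empty) set $\mathbb A x\subseteq\mathcal H$. It is *monotone* if $\langle x-y,u-v\rangle\ge 0$, *$\mu$-strongly monotone* if $\langle x-y,u-v\rangle\ge\mu\|x-y\|^2$, *$L$-Lipschitz* if $\|u-v\|^2\le L^2\|x-y\|^2$, and *$\beta$-cocoercive* if $\langle x-y,u-v\rangle\ge\beta\|u-v\|^2$, in each case for all $x,y\in\mathcal H$, $u\in\mathbb A x$, $v\in\mathbb A y$. It is *$\rho$-contractive* if $0\le\rho<1$ and $\|u-v\|\le\rho\|x-y\|$ for all $x,y\in\mathcal H$, $u\in\mathbb A x$, $v\in\mathbb A y$. Sums, scalar multiples, compositions and inverses of operators are those of their graphs, $\mathbb I$ is the identity, and $\mathbb J_{\alpha\mathbb A}=(\mathbb I+\alpha\mathbb A)^{-1}$ is the resolvent. For $\alpha,\lambda>0$ the Davis--Yin splitting (DYS) operator of $\mathbb A,\mathbb B,\mathbb C$ is $$\mathbb T_{\mathbb A,\mathbb B,\mathbb C,\alpha,\lambda}=(1-\lambda)\mathbb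 I+\lambda\bigl(\mathbb I-\mathbb J_{\alpha\mathbb B}+\mathbb J_{\alpha\mathbb A}(2\mathbb J_{\alpha\mathbb B}-\mathbb I-\alpha\mathbb C\mathbb J_{\alpha\mathbb B})\bigr).$$ **Theorem.** Let $0<\alpha<4\beta_{\mathcal C}<\infty$ and $\lambda\in\bigl(0,\,2-\frac{\alpha}{2\beta_{\mathcal C}}\bigr)$. Let $\mathbb A,\mathbb B:\mathcal H\rightrightarrows\mathcal H$ be monotone and let $\mathbb C:\mathcal H\rightrightarrows\mathcal H$ be $\beta_{\mathcal C}$-cocoercive. If $\mathbb A$ is $L$-Lipschitz and $\mu$-strongly monotone, where $0<\mu\le L<\infty$, then $\mathbb T_{\mathbb A,\mathbb B,\mathbb C,\alpha,\lambda}$ is $\rho$-contractive with $$\rho=1-\frac{2\lambda}{4-\alpha/\beta_{\mathcal C}}+\lambda\sqrt{\frac{2}{4-\alpha/\beta_{\mathcal C}}\left(\frac{2}{4-\alpha/\beta_{\mathcal C}}-\frac{2\alpha\mu}{\alpha^2L^2+2\alpha\mu+1}\right)}.$$ Symmetrically, if instead $\mathbb B$ is $L$-Lipschitz and $\mu$-strongly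 monotone, where $0<\mu\le L<\infty$, then $\mathbb T_{\mathbb A,\mathbb B,\mathbb C,\alpha,\lambda}$ is $\rho$-contractive with the same $\rho$. -/

import Mathlib

/-- A multi-valued operator on `H`: it sends each point to a (possibly empty) set of points. -/
abbrev MultiOp (H : Type*) := H → Set H

namespace MultiOp

variable {H : Type*} [NormedAddCommGroup H] [InnerProductSpace ℝ H]

/-- The identity operator `I`. -/
def ident (H : Type*) : MultiOp H := fun x => {u | u = x}

/-- The inverse operator, obtained by swapping the two components of the graph. -/
def inv (A : MultiOp H) : MultiOp H := fun u => {x | u ∈ A x}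

/-- The scalar multiple `c A = {(x, c u) | (x, u) ∈ A}`. -/
def scale (c : ℝ) (A : MultiOp H) : MultiOp H := fun x => {w | ∃ u ∈ A x, w = c • u}

/-- The sum `A + B = {(x, u + v) | (x, u) ∈ A, (x, v) ∈ B}`. -/
def sum (A B : MultiOp H) : MultiOp H := fun x => {w | ∃ u ∈ A x, ∃ v ∈ B x, w = u + v}

/-- The difference `A - B = {(x, u - v) | (x, u) ∈ A, (x, v) ∈ B}`. -/
def diff (A B : MultiOp H) : MultiOp H := fun x => {w | ∃ u ∈ A x, ∃ v ∈ B x, w = u - v}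

/-- The composition `A B = {(x, s) | ∃ u, (x, u) ∈ B, (u, s) ∈ A}`. -/
def comp (A B : MultiOp H) : MultiOp H := fun x => {s | ∃ u ∈ B x, s ∈ A u}

/-- The resolvent `J_{αA} = (I + αA)⁻¹`. -/
def resolvent (α : ℝ) (A : MultiOp H) : MultiOp H := inv (sum (ident H) (scale α A))

/-- The Davis-Yin splitting operator with stepsize `α` and averaging parameter `lam`,
`(1 - lam) I + lam (I - J_{αB} + J_{αA} (2 J_{αB} - I - α C J_{αB}))`. -/
def davisYin (A B C : MultiOp H) (α lam : ℝ) : MultiOp H :=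
  sum (scale (1 - lam) (ident H))
    (scale lam
      (sum (diff (ident H) (resolvent α B))
        (comp (resolvent α A)
          (diff (diff (scale 2 (resolvent α B)) (ident H))
            (scale α (comp C (resolvent α B)))))))

/-- Monotone operators (not necessarily maximal). -/
def Monotone (A : MultiOp H) : Prop :=
  ∀ x y : H, ∀ u ∈ A x, ∀ v ∈ A y, 0 ≤ inner ℝ (x - y) (u - v)

/-- `μ`-strongly monotone operators. -/
def StronglyMonotone (μ : ℝ) (A : MultiOp H) : Prop :=
  ∀ x y : H, ∀ u ∈ A x, ∀ v ∈ A y, μ * ‖x - y‖ ^ 2 ≤ inner ℝ (x - y) (u - v)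

/-- `L`-Lipschitz operators, on their domain. For `x = y` the inequality gives `u = v`, so such an
operator is single-valued. -/
def Lipschitz (L : ℝ) (A : MultiOp H) : Prop :=
  ∀ x y : H, ∀ u ∈ A x, ∀ v ∈ A y, ‖u - v‖ ^ 2 ≤ L ^ 2 * ‖x - y‖ ^ 2

/-- `β`-cocoercive operators, on their domain. For `β > 0` and `x = y` the inequality gives
`u = v`, so such an operator is single-valued. -/
def Cocoercive (β : ℝ) (A : MultiOp H) : Prop :=
  ∀ x y : H, ∀ u ∈ A x, ∀ v ∈ A y, β * ‖u - v‖ ^ 2 ≤ inner ℝ (x - y) (u - v)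

/-- `ρ`-contractive operators: the factor satisfies `0 ≤ ρ < 1`, and the operator is Lipschitz on
its domain (hence single-valued) with constant `ρ`. -/
def Contractive (ρ : ℝ) (T : MultiOp H) : Prop :=
  0 ≤ ρ ∧ ρ < 1 ∧ ∀ x y : H, ∀ u ∈ T x, ∀ v ∈ T y, ‖u - v‖ ≤ ρ * ‖x - y‖

end MultiOp

/-!
Write `z = x + αb` with `b ∈ B x`, so that `x = J_{αB} z`, take `c ∈ C x`, and let
`w = J_{αA} (2x - z - αc)` with `a ∈ A w`. Then `x - w = α(a + b + c)`, and the operator sends `z`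
to `z - λ(x - w)`. From here on these letters stand for the differences between two such runs,
with `α` absorbed into `a, b, c`, and `d = x - w`, `h = α / (2β)`,
`κ = 2αμ / (α²L² + 2αμ + 1)`.

* Strong monotonicity and the Lipschitz bound of one operator enter only as
  `κ ‖p + q‖² ≤ 2 ⟪p, q⟫` for its pairs `(p, q)` (`kappa_mul_norm_add_sq_le`); here `κ ≤ 1/2`.
* Both parts of the theorem reduce to the same inequality
  `κ ‖z‖² + (2 - h) ‖d‖² ≤ 2 ⟪d, z⟫`. Completing the square, it says that
  `‖z - (2 - h) d‖² ≤ (1 - (2 - h) κ) ‖z‖²`, so `z - λd`, a convex combination of `z` and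
  `z - (2 - h) d`, has norm at most `ρ ‖z‖` (`norm_sub_smul_le`).
* If `B` is the regular operator, completing a square in `c` gives the inequality
  (`key_inequality_of_inner`). If `A` is, the gap between the two sides is, for `κ < 1/2`, a
  nonnegative combination of the hypotheses plus a square that involves `x, w, a, c`; at
  `κ = 1/2` the hypothesis forces `w = a` and the gap is at least `h ‖w‖²`
  (`key_inequality_of_resolvent`).
-/

namespace MultiOp

/-! ### Inequalities for five vectors -/

section Vectors

variable {H : Type*} [NormedAddCommGroup H] [InnerProductSpace ℝ H]

lemma kappa_mul_norm_add_sq_le {m l : ℝ} (hm : 0 < m) {p q : H}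
    (hl : ‖q‖ ^ 2 ≤ l ^ 2 * ‖p‖ ^ 2) (hmono : m * ‖p‖ ^ 2 ≤ inner ℝ p q) :
    2 * m / (l ^ 2 + 2 * m + 1) * ‖p + q‖ ^ 2 ≤ 2 * inner ℝ p q := by
  have hD : 0 < l ^ 2 + 2 * m + 1 := by positivity
  rw [div_mul_eq_mul_div, div_le_iff₀ hD, norm_add_sq_real]
  nlinarith [mul_le_mul_of_nonneg_left hl hm.le,
    mul_le_mul_of_nonneg_left hmono (by positivity : 0 ≤ l ^ 2 + 1)]

lemma kappa_le_half {m l : ℝ} (hm : 0 < m) (hml : m ≤ l) :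
    2 * m / (l ^ 2 + 2 * m + 1) ≤ 1 / 2 := by
  have hD : 0 < l ^ 2 + 2 * m + 1 := by positivity
  rw [div_le_iff₀ hD]
  nlinarith [sq_nonneg (l - 1)]

/-- The key inequality when the operator `B` of the inner resolvent is the regular one: the gap is
at least `2 ⟪w, a⟫` plus the square `‖c - h d‖² / h`, where `d = x - w`. -/
lemma key_inequality_of_inner {h κ : ℝ} (hh : 0 < h) {x b c w a : H}
    (hd : x - w = a + b + c) (hP : 0 ≤ inner ℝ w a)
    (hX : κ * ‖x + b‖ ^ 2 ≤ 2 * inner ℝ x b) (hG : ‖c‖ ^ 2 ≤ 2 * h * inner ℝ x c) :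
    κ * ‖x + b‖ ^ 2 + (2 - h) * ‖x - w‖ ^ 2 ≤ 2 * inner ℝ (x - w) (x + b) := by
  obtain rfl : w = x - (a + b + c) := by rw [← hd]; abel
  have hsq : 0 ≤ ‖c - h • (a + b + c)‖ ^ 2 := sq_nonneg _
  refine le_trans (add_le_add_left hX _) (le_of_mul_le_mul_left ?_ hh)
  have hP' := mul_nonneg hh.le hP
  clear hP hX hd
  simp only [← real_inner_self_eq_norm_sq, inner_add_left, inner_add_right, inner_sub_left,
    inner_sub_right, real_inner_smul_left, real_inner_smul_right] at *
  rw [real_inner_comm x a, real_inner_comm x b, real_inner_comm x c, real_inner_comm a b,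
    real_inner_comm a c, real_inner_comm b c] at *
  nlinarith

/-- The key inequality when the operator `A` of the outer resolvent is the regular one. With
`u = (1 - κ) w - κ a` one has
`(1 - 2κ) ‖w‖² - ‖u‖² = κ (2 ⟪w, a⟫ - κ ‖w + a‖²)`, which absorbs the cross terms
between `x` and `(w, a)`. -/
lemma key_inequality_of_resolvent {h κ : ℝ} (hh : 0 < h) (hκ : 0 ≤ κ) (hκ' : κ ≤ 1 / 2)
    {x b c w a : H} (hd : x - w = a + b + c)
    (hP : κ * ‖w + a‖ ^ 2 ≤ 2 * inner ℝ w a)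
    (hX : 0 ≤ inner ℝ x b) (hG : ‖c‖ ^ 2 ≤ 2 * h * inner ℝ x c) :
    κ * ‖x + b‖ ^ 2 + (2 - h) * ‖x - w‖ ^ 2 ≤ 2 * inner ℝ (x - w) (x + b) := by
  obtain rfl : b = x - w - a - c := by rw [hd]; abel
  rcases hκ'.lt_or_eq with hlt | rfl
  · have hk : 0 < 1 - 2 * κ := by linarith
    have hsq : 0 ≤ ‖(h * (1 - 2 * κ)) • x - h • ((1 - κ) • w - κ • a) - (1 - 2 * κ) • c‖ ^ 2 :=
      sq_nonneg _
    refine le_of_mul_le_mul_left ?_ (mul_pos hh hk)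
    have hq : 0 ≤ 2 - 4 * κ + 2 * κ * h := by nlinarith [mul_nonneg hκ hh.le]
    have hX' := mul_nonneg (mul_nonneg (mul_nonneg hh.le hk.le) hq) hX
    have hG' := mul_nonneg (mul_nonneg hk.le hq) (sub_nonneg.2 hG)
    have hP' := mul_nonneg (mul_nonneg hh.le (by positivity : 0 ≤ 1 - 2 * κ + h * κ))
      (sub_nonneg.2 hP)
    clear hP hX hG
    simp only [← real_inner_self_eq_norm_sq, inner_add_left, inner_add_right, inner_sub_left,
      inner_sub_right, real_inner_smul_left, real_inner_smul_right] at *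
    rw [real_inner_comm x w, real_inner_comm x a, real_inner_comm x c, real_inner_comm w a,
      real_inner_comm w c, real_inner_comm a c] at *
    nlinarith
  · -- At `κ = 1/2` the hypothesis on `(w, a)` reads `‖w - a‖² ≤ 0`.
    obtain rfl : w = a := by
      have h0 : ‖w - a‖ ^ 2 ≤ 0 := by
        rw [norm_add_sq_real] at hP
        rw [norm_sub_sq_real]
        linarith
      exact sub_eq_zero.1 (norm_eq_zero.1 (pow_eq_zero_iff two_ne_zero |>.1
        (le_antisymm h0 (sq_nonneg _))))
    have hX' := mul_nonneg hh.le hX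
    have hw : 0 ≤ h * ‖w‖ ^ 2 := by positivity
    clear hP hX
    simp only [← real_inner_self_eq_norm_sq, inner_add_left, inner_add_right, inner_sub_left,
      inner_sub_right] at *
    rw [real_inner_comm x w, real_inner_comm x c, real_inner_comm w c] at *
    nlinarith

/-- `z - λd = (1 - λθ) z + λθ (z - θ⁻¹ d)`, and the key inequality bounds
`‖θ z - d‖² ≤ θ (θ - κ) ‖z‖²`; here `θ⁻¹ = 2 - h`. -/
lemma norm_sub_smul_le {θ κ lam : ℝ} (hθ : 0 < θ) (hκ : κ ≤ θ) (hlam : 0 ≤ lam)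
    (hlamθ : lam * θ ≤ 1) {z d : H}
    (hkey : κ * ‖z‖ ^ 2 + θ⁻¹ * ‖d‖ ^ 2 ≤ 2 * inner ℝ d z) :
    ‖z - lam • d‖ ≤ (1 - lam * θ + lam * Real.sqrt (θ * (θ - κ))) * ‖z‖ := by
  have hbound : ‖θ • z - d‖ ≤ Real.sqrt (θ * (θ - κ)) * ‖z‖ := by
    refine le_of_sq_le_sq ?_ (by positivity)
    rw [mul_pow, Real.sq_sqrt (mul_nonneg hθ.le (sub_nonneg.2 hκ)), norm_sub_sq_real, norm_smul,
      real_inner_smul_left, real_inner_comm, Real.norm_of_nonneg hθ.le]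
    have := mul_le_mul_of_nonneg_left hkey hθ.le
    rw [mul_add, mul_inv_cancel_left₀ hθ.ne'] at this
    linarith
  calc ‖z - lam • d‖ = ‖(1 - lam * θ) • z + lam • (θ • z - d)‖ := by
        congr 1; module
    _ ≤ ‖(1 - lam * θ) • z‖ + ‖lam • (θ • z - d)‖ := norm_add_le _ _
    _ = (1 - lam * θ) * ‖z‖ + lam * ‖θ • z - d‖ := by
        rw [norm_smul, norm_smul, Real.norm_of_nonneg hlam, Real.norm_of_nonneg (by linarith)]
    _ ≤ (1 - lam * θ) * ‖z‖ + lam * (Real.sqrt (θ * (θ - κ)) * ‖z‖) := by gcongr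
    _ = _ := by ring

end Vectors

/-! ### The graph of the Davis–Yin operator -/

section Graph

variable {H : Type*} [NormedAddCommGroup H] [InnerProductSpace ℝ H]

lemma mem_resolvent_iff {α : ℝ} {A : MultiOp H} {z x : H} :
    x ∈ resolvent α A z ↔ ∃ u ∈ A x, z = x + α • u := by
  simp [resolvent, inv, sum, ident, scale]

lemma Monotone.resolvent_unique {α : ℝ} (hα : 0 < α) {A : MultiOp H} (hA : A.Monotone)
    {z x y : H} (hx : x ∈ resolvent α A z) (hy : y ∈ resolvent α A z) : x = y := by
  obtain ⟨u, hu, hz⟩ := mem_resolvent_iff.1 hx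
  obtain ⟨v, hv, hz'⟩ := mem_resolvent_iff.1 hy
  have hxy : x - y = -(α • (u - v)) := by
    rw [eq_sub_of_add_eq hz.symm, eq_sub_of_add_eq hz'.symm]; module
  have hmono := mul_nonneg hα.le (hA x y u hu v hv)
  have hle : inner ℝ (x - y) (x - y) ≤ 0 := by
    nth_rw 2 [hxy]
    rw [inner_neg_right, real_inner_smul_right]
    linarith
  exact sub_eq_zero.1 (inner_self_eq_zero.1 (le_antisymm hle real_inner_self_nonneg))

/-- Every value of the Davis–Yin operator comes from one run of the splitting scheme. The three
occurrences of `J_{αB}` are chosen independently in the graph calculus, and monotonicity of `B`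
makes the choices agree. -/
lemma exists_of_mem_davisYin {α lam : ℝ} (hα : 0 < α) {A B C : MultiOp H} (hB : B.Monotone)
    {z t : H} (ht : t ∈ davisYin A B C α lam z) :
    ∃ x w, ∃ b ∈ B x, ∃ c ∈ C x, ∃ a ∈ A w,
      z = x + α • b ∧ x - w = α • a + α • b + α • c ∧ t = z - lam • (x - w) := by
  obtain ⟨_, ⟨_, rfl, rfl⟩, _, ⟨_, ⟨_, ⟨_, rfl, x, hx, rfl⟩, w, ⟨_, ⟨_, ⟨_, ⟨x₂, hx₂, rfl⟩, _,
    rfl, rfl⟩, _, ⟨c, ⟨x₃, hx₃, hc⟩, rfl⟩, rfl⟩, hw⟩, rfl⟩, rfl⟩, rfl⟩ := ht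
  obtain rfl := hB.resolvent_unique hα hx hx₂
  obtain rfl := hB.resolvent_unique hα hx hx₃
  obtain ⟨b, hb, hz⟩ := mem_resolvent_iff.1 hx
  obtain ⟨a, ha, hy⟩ := mem_resolvent_iff.1 hw
  refine ⟨x, w, b, hb, c, hc, a, ha, hz, ?_, by module⟩
  rw [hz] at hy
  have hw' := eq_sub_of_add_eq hy.symm
  rw [hw']; module

/-- The contraction estimate, given the key inequality for differences of any two runs of the
splitting scheme with stepsize `α`. -/
lemma davisYin_contractive {α β lam κ : ℝ} (hα : 0 < α) (hαβ : α < 4 * β) (hlam : 0 < lam)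
    (hlam' : lam < 2 - α / (2 * β)) (hκ : 0 < κ) (hκ' : κ ≤ 1 / 2) {A B C : MultiOp H}
    (hB : B.Monotone) (hC : C.Cocoercive β)
    (hkey : ∀ x x' w w' : H, ∀ b ∈ B x, ∀ b' ∈ B x', ∀ a ∈ A w, ∀ a' ∈ A w', ∀ c : H,
      (x - x') - (w - w') = α • (a - a') + α • (b - b') + c →
      ‖c‖ ^ 2 ≤ 2 * (α / (2 * β)) * inner ℝ (x - x') c →
      κ * ‖(x - x') + α • (b - b')‖ ^ 2
          + (2 - α / (2 * β)) * ‖(x - x') - (w - w')‖ ^ 2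
        ≤ 2 * inner ℝ ((x - x') - (w - w')) ((x - x') + α • (b - b'))) :
    (davisYin A B C α lam).Contractive
      (1 - 2 * lam / (4 - α / β)
        + lam * Real.sqrt (2 / (4 - α / β) * (2 / (4 - α / β) - κ))) := by
  have hβ : 0 < β := by linarith
  have hs : 0 < 4 - α / β := by
    rw [sub_pos, div_lt_iff₀ hβ]; exact hαβ
  have hh : 2 - α / (2 * β) = (4 - α / β) / 2 := by field_simp; ring
  have hsub : 4 - α / β < 4 := by linarith [div_pos hα hβ]
  set θ : ℝ := 2 / (4 - α / β) with hθdef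
  have hθ : 0 < θ := by positivity
  have hθinv : θ⁻¹ = 2 - α / (2 * β) := by rw [hh, hθdef, inv_div]
  have hκθ : κ < θ := by
    refine hκ'.trans_lt ?_
    rw [hθdef, lt_div_iff₀ hs]; linarith
  have hlamθ : lam * θ < 1 := by
    rw [← hθinv] at hlam'
    exact (lt_inv_mul_iff₀' hθ).1 (by simpa using hlam')
  have hsqrt : Real.sqrt (θ * (θ - κ)) < θ := by
    rw [Real.sqrt_lt' hθ]; nlinarith
  have hρ : 2 * lam / (4 - α / β) = lam * θ := by rw [hθdef]; ring
  rw [hρ]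
  refine ⟨?_, ?_, ?_⟩
  · have := mul_nonneg hlam.le (Real.sqrt_nonneg (θ * (θ - κ)))
    linarith
  · nlinarith
  · intro z z' t ht t' ht'
    obtain ⟨x, w, b, hb, c, hc, a, ha, hz, hd, rfl⟩ := exists_of_mem_davisYin hα hB ht
    obtain ⟨x', w', b', hb', c', hc', a', ha', hz', hd', rfl⟩ :=
      exists_of_mem_davisYin hα hB ht'
    have hzz : z - z' = (x - x') + α • (b - b') := by rw [hz, hz']; module
    have hstep : z - lam • (x - w) - (z' - lam • (x' - w'))
        = (z - z') - lam • ((x - x') - (w - w')) := by module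
    rw [hstep]
    refine norm_sub_smul_le hθ hκθ.le hlam.le hlamθ.le ?_
    rw [hθinv, hzz]
    refine hkey x x' w w' b hb b' hb' a ha a' ha' (α • (c - c')) ?_ ?_
    · rw [sub_sub_sub_comm, hd, hd']; module
    · have hco := mul_le_mul_of_nonneg_left (hC x x' c hc c' hc') (by positivity : 0 ≤ α ^ 2 / β)
      rw [norm_smul, Real.norm_of_nonneg hα.le, real_inner_smul_right]
      calc (α * ‖c - c'‖) ^ 2 = α ^ 2 / β * (β * ‖c - c'‖ ^ 2) := by field_simp
        _ ≤ _ := hco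
        _ = _ := by field_simp

/-- Pairs in the graph of `αA` satisfy the inequality through which regularity of `A` enters. -/
lemma StronglyMonotone.kappa_le {α μ L : ℝ} (hα : 0 < α) (hμ : 0 < μ) {A : MultiOp H}
    (hL : A.Lipschitz L) (hS : A.StronglyMonotone μ) {x y u v : H} (hu : u ∈ A x) (hv : v ∈ A y) :
    2 * α * μ / (α ^ 2 * L ^ 2 + 2 * α * μ + 1) * ‖(x - y) + α • (u - v)‖ ^ 2
      ≤ 2 * inner ℝ (x - y) (α • (u - v)) := by
  have key := kappa_mul_norm_add_sq_le (m := α * μ) (l := α * L) (by positivity)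
    (p := x - y) (q := α • (u - v)) ?_ ?_
  · convert key using 3 <;> ring
  · rw [norm_smul, Real.norm_of_nonneg hα.le, mul_pow, mul_pow, mul_assoc]
    exact mul_le_mul_of_nonneg_left (hL x y u hu v hv) (by positivity)
  · rw [real_inner_smul_right, mul_assoc]
    exact mul_le_mul_of_nonneg_left (hS x y u hu v hv) hα.le

lemma Monotone.inner_smul_nonneg {α : ℝ} (hα : 0 < α) {A : MultiOp H} (hA : A.Monotone)
    {x y u v : H} (hu : u ∈ A x) (hv : v ∈ A y) : 0 ≤ inner ℝ (x - y) (α • (u - v)) := by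
  rw [real_inner_smul_right]
  exact mul_nonneg hα.le (hA x y u hu v hv)

end Graph

end MultiOp

/-! ### Contraction with either operator regular -/

theorem theorem3 {H : Type*} [NormedAddCommGroup H] [InnerProductSpace ℝ H] [CompleteSpace H]
    (α β lam : ℝ) (hα : 0 < α) (hαβ : α < 4 * β)
    (hlam : 0 < lam) (hlam' : lam < 2 - α / (2 * β))
    (A B C : MultiOp H) (hA : A.Monotone) (hB : B.Monotone) (hC : C.Cocoercive β) :
    (∀ μ L : ℝ, 0 < μ → μ ≤ L → A.Lipschitz L → A.StronglyMonotone μ →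
      (MultiOp.davisYin A B C α lam).Contractive
        (1 - 2 * lam / (4 - α / β)
          + lam * Real.sqrt (2 / (4 - α / β)
              * (2 / (4 - α / β) - 2 * α * μ / (α ^ 2 * L ^ 2 + 2 * α * μ + 1))))) ∧
    (∀ μ L : ℝ, 0 < μ → μ ≤ L → B.Lipschitz L → B.StronglyMonotone μ →
      (MultiOp.davisYin A B C α lam).Contractive
        (1 - 2 * lam / (4 - α / β)
          + lam * Real.sqrt (2 / (4 - α / β)
              * (2 / (4 - α / β) - 2 * α * μ / (α ^ 2 * L ^ 2 + 2 * α * μ + 1))))) := by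
  have hβ : 0 < β := by linarith
  have hh : 0 < α / (2 * β) := by positivity
  have hκ : ∀ μ L : ℝ, 0 < μ → μ ≤ L →
      0 < 2 * α * μ / (α ^ 2 * L ^ 2 + 2 * α * μ + 1) ∧
        2 * α * μ / (α ^ 2 * L ^ 2 + 2 * α * μ + 1) ≤ 1 / 2 := by
    intro μ L hμ hμL
    refine ⟨by positivity, ?_⟩
    have := MultiOp.kappa_le_half (mul_pos hα hμ) (mul_le_mul_of_nonneg_left hμL hα.le)
    rwa [mul_pow, ← mul_assoc] at this
  refine ⟨fun μ L hμ hμL hL hS => ?_, fun μ L hμ hμL hL hS => ?_⟩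
  · obtain ⟨hκ₀, hκ₁⟩ := hκ μ L hμ hμL
    refine MultiOp.davisYin_contractive hα hαβ hlam hlam' hκ₀ hκ₁ hB hC ?_
    intro x x' w w' b hb b' hb' a ha a' ha' c hd hc
    exact MultiOp.key_inequality_of_resolvent hh hκ₀.le hκ₁ hd (hS.kappa_le hα hμ hL ha ha')
      (hB.inner_smul_nonneg hα hb hb') hc
  · obtain ⟨hκ₀, hκ₁⟩ := hκ μ L hμ hμL
    refine MultiOp.davisYin_contractive hα hαβ hlam hlam' hκ₀ hκ₁ hB hC ?_
    intro x x' w w' b hb b' hb' a ha a' ha' c hd hc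
    exact MultiOp.key_inequality_of_inner hh hd (hA.inner_smul_nonneg hα ha ha')
      (hS.kappa_le hα hμ hL hb hb') hc
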